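/- By a \emph{surface group} we mean the fundamental group of a closed oriented surface of genus $g\ge 2$, that is, a group isomorphic to $\langle a_1,b_1,\dots,a_g,b_g \mid [a_1,b_1]\cdots[a_g,b_g]=1\rangle$ for some $g\ge 2$. A group $G$ is a \emph{polysurface group of length $n$} if there is a filtration $$\{e\}=G_0<G_1<\cdots<G_n=G$$ by subgroups such that each $G_i$ is normal in $G$ and $G_i/G_{i-1}$ is isomorphic to a surface group for each $1\le i\le n$. \textbf{Proposition.} Let $G$ be a polysurface group (of some length $n$), let $A$ be a finite abelian group, and let $$0\longrightarrow A\longrightarrow \Gamma\stackrel{\pi}{\longrightarrow} G\longrightarrow 0$$ be a central extension. Then there is a subgroup $H\le G$ of finite index such that the restricted extension $$0\longrightarrow A\longrightarrow \pi^{-1}(H)\longrightarrow H\longrightarrow 0$$ is trivial, i.e. equivalent, as an extension of $H$ by $A$, to the direct product $0\to A\to A\times H\to H\to 0$. -/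

import Mathlib

/-- The word `[a₁, b₁] [a₂, b₂] ⋯ [a_g, b_g]` in the free group on `a₁, …, a_g` (left summand)
and `b₁, …, b_g` (right summand). -/
def surfaceRelator (g : ℕ) : FreeGroup (Fin g ⊕ Fin g) :=
  (List.ofFn fun i : Fin g =>
    let a : FreeGroup (Fin g ⊕ Fin g) := FreeGroup.of (Sum.inl i)
    let b : FreeGroup (Fin g ⊕ Fin g) := FreeGroup.of (Sum.inr i)
    a * b * a⁻¹ * b⁻¹).prod

/-- The fundamental group of the closed oriented surface of genus `g`, in its standard form
`⟨a₁, b₁, …, a_g, b_g | [a₁, b₁] ⋯ [a_g, b_g] = 1⟩`: the surface is obtained from a bouquet of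
`2g` oriented circles by attaching one disc along the word `surfaceRelator g`. -/
abbrev SurfaceGroup (g : ℕ) : Type := PresentedGroup {surfaceRelator g}

/-- A surface group is a group isomorphic to the fundamental group of a closed oriented surface
of genus greater than one. -/
def IsSurfaceGroup (G : Type*) [Group G] : Prop :=
  ∃ g : ℕ, 2 ≤ g ∧ Nonempty (G ≃* SurfaceGroup g)

/-- `G` is a polysurface group of length `n`: there is a filtration
`{e} = G₀ < G₁ < ⋯ < G_n = G` by subgroups that are all normal in `G` (not only each in the next)
such that every successive quotient is a surface group. -/
def IsPolysurfaceGroup (G : Type*) [Group G] (n : ℕ) : Prop :=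
  ∃ (F : Fin (n + 1) → Subgroup G) (_ : ∀ i, (F i).Normal),
    F 0 = ⊥ ∧ F (Fin.last n) = ⊤ ∧ StrictMono F ∧
      ∀ i : Fin n, IsSurfaceGroup (F i.succ ⧸ (F i.castSucc).subgroupOf (F i.succ))

namespace GroupExtension

/-- The extension `1 → A → E → G → 1` is central: the image of `A` lies in the center of `E`. -/
def IsCentral {A E G : Type*} [Group A] [Group E] [Group G] (S : GroupExtension A E G) : Prop :=
  S.inl.range ≤ Subgroup.center E

/-- The restriction of `1 → A → E → G → 1` to a subgroup `H` of `G`, i.e. the extension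
`1 → A → π⁻¹(H) → H → 1`, where `π : E → G` is the projection. -/
def restrict {A E G : Type*} [Group A] [Group E] [Group G] (S : GroupExtension A E G)
    (H : Subgroup G) : GroupExtension A (H.comap S.rightHom) H where
  inl := S.inl.codRestrict (H.comap S.rightHom) fun a => by
    rw [Subgroup.mem_comap, S.rightHom_inl]
    exact H.one_mem
  rightHom := S.rightHom.subgroupComap H
  inl_injective := fun a b h => S.inl_injective (congrArg Subtype.val h)
  range_inl_eq_ker_rightHom := by
    ext x
    have hx : (x : E) ∈ S.inl.range ↔ (x : E) ∈ S.rightHom.ker := by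
      rw [S.range_inl_eq_ker_rightHom]
    constructor
    · rintro ⟨a, rfl⟩
      exact Subtype.ext (S.rightHom_inl a)
    · intro h
      obtain ⟨a, ha⟩ := hx.2 (congrArg Subtype.val h)
      exact ⟨a, Subtype.ext ha⟩
  rightHom_surjective := fun y => by
    obtain ⟨x, hx⟩ := S.rightHom_surjective y
    exact ⟨⟨x, by rw [Subgroup.mem_comap, hx]; exact y.2⟩, Subtype.ext hx⟩

/-- The trivial extension `1 → A → A × G → G → 1`. -/
def directProduct (A G : Type*) [Group A] [Group G] : GroupExtension A (A × G) G where
  inl := MonoidHom.inl A G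
  rightHom := MonoidHom.snd A G
  inl_injective := fun _ _ h => congrArg Prod.fst h
  range_inl_eq_ker_rightHom := by
    ext ⟨a, g⟩
    constructor
    · rintro ⟨b, hb⟩
      exact (congrArg Prod.snd hb).symm
    · intro h
      exact ⟨a, Prod.ext rfl (Eq.symm h)⟩
  rightHom_surjective := fun g => ⟨(1, g), rfl⟩

/-- An extension is trivial if it is equivalent, as an extension, to the direct product. -/
def IsTrivial {A E G : Type*} [Group A] [Group E] [Group G] (S : GroupExtension A E G) : Prop :=
  Nonempty (S.Equiv (directProduct A G))

end GroupExtension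

/-!
A central extension `1 → A → Γ → G → 1` splits over a subgroup of finite index as soon as `Γ` has a
subgroup `K` of finite index with `K ∩ A = 1`: the projection maps `K` isomorphically onto a subgroup
`H` of finite index in `G`, and centrality of `A` turns the section `H → K` into an equivalence with
`A × H` (`GroupExtension.isTrivial_restrict_range`). Such a `K` is found without cohomology.

**Climbing the filtration** (`IsPolysurfaceGroup.exists_finiteIndex_disjoint_ker`). Let `Γᵢ` be the
preimage of `Gᵢ`. Suppose that `Kᵢ` has finite index in `Γᵢ`, is normal in `Γ`, and misses `A`. Then
`Γᵢ₊₁ / Kᵢ` is an extension of a surface group by the finite group `Γᵢ / Kᵢ`. If it has a subgroup of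
finite index that misses `Γᵢ / Kᵢ`, the preimage of that subgroup in `Γᵢ₊₁` misses `A`, and as `Γᵢ₊₁`
is finitely generated it can be shrunk to a characteristic subgroup, which is normal in `Γ`. So it
suffices to treat extensions of surface groups by finite groups, central or not.

**Surface groups** (`MonoidHom.exists_finiteIndex_disjoint_ker`). Passing to the centralizer of the
finite kernel makes the extension central, at the price of replacing the surface group by a subgroup
of finite index. Rather than identifying that subgroup, the argument uses a property inherited by
subgroups: there is a homomorphism to `ℤ` with free kernel (`SurfaceGroup.isFreeByCyclic`). The kernel
is the fundamental group of an infinite cyclic cover of the surface, and the surface group embeds in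
an explicit semidirect product of a free group with `ℤ`.

**The central case.** Let `Γ` be finitely generated, `A` finite and central in `Γ`, and `E ⊇ A` the
kernel of a homomorphism `Γ → ℤ` such that `E / A` is free. Then `E → E / A` splits, so `A` is a
retract of `E` and embeds in `Eᵃᵇ` (`MonoidHom.disjoint_commutator_ker_of_free`). Since `Γ` is
finitely generated, `Eᵃᵇ` is a finitely generated module over the Noetherian ring `ℤ[t, t⁻¹]`, and `A`
is a submodule killed by the ideal `I = (|A|, t - 1)` of finite index. By the Artin–Rees lemma some
`I ^ n Eᵃᵇ`, which has finite index in `Eᵃᵇ`, misses `A`. Its preimage in `E` together with a lift of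
a generator of the image of `Γ` in `ℤ` generates the required subgroup
(`Subgroup.exists_finiteIndex_disjoint_of_zpowers_complement`).
-/

/-! ### Finite submodules with trivial action -/

/-- A submodule `N` killed by an ideal `I` of finite index meets some submodule of finite index
trivially. By the Artin–Rees lemma, `I ^ (k + 1) • ⊤ ⊓ N ≤ I • N` for large `k`. -/
theorem Submodule.exists_finite_quotient_disjoint {R M : Type*} [CommRing R] [IsNoetherianRing R]
    [AddCommGroup M] [Module R M] [Module.Finite R M] (I : Ideal R) [Finite (R ⧸ I)]
    (N : Submodule R M) (hN : I • N = ⊥) :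
    ∃ C : Submodule R M, Finite (M ⧸ C) ∧ Disjoint C N := by
  obtain ⟨k, hk⟩ := I.exists_pow_inf_eq_pow_smul N
  refine ⟨I ^ (k + 1) • ⊤, ?_, ?_⟩
  · have := Ideal.finite_quotient_pow (IsNoetherian.noetherian I) (k + 1)
    have : Finite (M ⧸ (⊤ : Submodule R M)) := inferInstance
    exact Submodule.finite_quotient_smul _ Module.Finite.fg_top
  · rw [disjoint_iff, eq_bot_iff, hk (k + 1) (Nat.le_succ k), Nat.add_sub_cancel_left, pow_one,
      ← hN]
    exact smul_mono_right I inf_le_right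

theorem Representation.asModuleEquiv_symm_apply_mem {k G V : Type*} [CommSemiring k] [Monoid G]
    [AddCommMonoid V] [Module k V] (ρ : Representation k G V)
    (W : Submodule (MonoidAlgebra k G) ρ.asModule) (g : G) {c : V}
    (hc : ρ.asModuleEquiv.symm c ∈ W) : ρ.asModuleEquiv.symm (ρ g c) ∈ W := by
  rw [ρ.asModuleEquiv_symm_map_rho]
  exact W.smul_mem _ hc

/-- In a finitely generated `ℤ[G]`-module with `G` a finitely generated abelian group, a finite
subgroup on which `G` acts trivially meets some `G`-stable subgroup of finite index trivially. -/
theorem Representation.exists_finite_quotient_disjoint {G B : Type*} [CommGroup G] [Group.FG G]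
    [AddCommGroup B] (ρ : Representation ℤ G B)
    [Module.Finite (MonoidAlgebra ℤ G) ρ.asModule] (A : AddSubgroup B) [Finite A]
    (hA : ∀ g, ∀ a ∈ A, ρ g a = a) :
    ∃ C : AddSubgroup B, C.FiniteIndex ∧ (∀ g, ∀ c ∈ C, ρ g c ∈ C) ∧ Disjoint C A := by
  have : IsNoetherianRing (MonoidAlgebra ℤ G) :=
    Algebra.FiniteType.isNoetherianRing ℤ (MonoidAlgebra ℤ G)
  -- `A` is a module over `ℤ[G]` through the augmentation `ε` reduced modulo the order of `A`.
  let ε : MonoidAlgebra ℤ G →+* ℤ := (MonoidAlgebra.lift ℤ ℤ G 1).toRingHom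
  let θ : MonoidAlgebra ℤ G →+* ZMod (Nat.card A) := (Int.castRingHom _).comp ε
  have : NeZero (Nat.card A) := ⟨Nat.card_pos.ne'⟩
  have : Finite (MonoidAlgebra ℤ G ⧸ RingHom.ker θ) :=
    Finite.of_injective _ (RingHom.kerLift_injective θ)
  have hact (r : MonoidAlgebra ℤ G) (a : B) (ha : a ∈ A) : ρ.asAlgebraHom r a = ε r • a := by
    induction r using MonoidAlgebra.induction_on with
    | of g => simp [ε, hA g a ha]
    | add x y hx hy => simp [hx, hy, add_smul]
    | smul n x hx =>
      have h : ε (n • x) = n • ε x := map_zsmul ε n x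
      rw [map_zsmul, LinearMap.smul_apply, hx, h, smul_assoc]
  -- `A`, viewed as a `ℤ[G]`-submodule.
  let N : Submodule (MonoidAlgebra ℤ G) ρ.asModule :=
    { carrier := {b | ρ.asModuleEquiv b ∈ A}
      add_mem' := fun ha hb => A.add_mem ha hb
      zero_mem' := A.zero_mem
      smul_mem' := fun r a ha => by
        change ρ.asModuleEquiv (r • a) ∈ A
        rw [ρ.asModuleEquiv_map_smul, hact r (ρ.asModuleEquiv a) ha]
        exact A.zsmul_mem ha _ }
  have hN : RingHom.ker θ • N = ⊥ := by
    rw [eq_bot_iff, Submodule.smul_le]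
    intro r hr a ha
    have hr' : ((Nat.card A : ℕ) : ℤ) ∣ ε r := (ZMod.intCast_zmod_eq_zero_iff_dvd _ _).1 hr
    obtain ⟨m, hm⟩ := hr'
    rw [Submodule.mem_bot]
    apply ρ.asModuleEquiv.injective
    rw [ρ.asModuleEquiv_map_smul, hact r (ρ.asModuleEquiv a) ha, hm, mul_comm, mul_smul,
      map_zero, natCast_zsmul]
    have h0 : Nat.card A • (⟨ρ.asModuleEquiv a, ha⟩ : A) = 0 := card_nsmul_eq_zero'
    have h1 : Nat.card A • ρ.asModuleEquiv a = 0 := congrArg Subtype.val h0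
    rw [h1, smul_zero]
  obtain ⟨C, hC, hCN⟩ := Submodule.exists_finite_quotient_disjoint (RingHom.ker θ) N hN
  have : C.toAddSubgroup.FiniteIndex := AddSubgroup.finiteIndex_iff_finite_quotient.2 hC
  refine ⟨C.toAddSubgroup.comap ρ.asModuleEquiv.symm.toAddEquiv.toAddMonoidHom, ⟨?_⟩,
    fun g c hc => ?_, ?_⟩
  · rw [AddSubgroup.index_comap_of_surjective _ (f := ρ.asModuleEquiv.symm.toAddEquiv.toAddMonoidHom)
      ρ.asModuleEquiv.symm.surjective]
    exact this.index_ne_zero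
  · exact ρ.asModuleEquiv_symm_apply_mem C g hc
  · rw [AddSubgroup.disjoint_def]
    intro c hc hcA
    have : ρ.asModuleEquiv.symm c = 0 := Submodule.disjoint_def.1 hCN _ hc hcA
    simpa using this

/-! ### Central extensions of free groups -/

/-- A central extension of a free group splits; equivalently, its kernel is a retract. The range of
`f` is free by the Nielsen–Schreier theorem, so `f` has a section `s` over it, and
`e ↦ e * (s (f e))⁻¹` is a retraction. -/
theorem MonoidHom.exists_retraction_of_free {E : Type*} {X : Type*} [Group E] (f : E →* FreeGroup X)
    (hf : f.ker ≤ Subgroup.center E) :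
    ∃ ρ : E →* f.ker, ∀ a : f.ker, ρ a = a := by
  obtain ⟨s, hs⟩ : ∃ s : f.range →* E, ∀ y, f.rangeRestrict (s y) = y := by
    let s : f.range →* E := IsFreeGroup.lift fun x =>
      Function.surjInv f.rangeRestrict_surjective (IsFreeGroup.of x)
    refine ⟨s, fun y => ?_⟩
    have : f.rangeRestrict.comp s = MonoidHom.id _ := IsFreeGroup.ext_hom fun a => by
      simp [s, Function.surjInv_eq]
    exact DFunLike.congr_fun this y
  have hs' (e : E) : f (s (f.rangeRestrict e)) = f e :=
    congrArg Subtype.val (hs (f.rangeRestrict e))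
  have hk (e : E) : e * (s (f.rangeRestrict e))⁻¹ ∈ f.ker := by
    rw [MonoidHom.mem_ker, map_mul, map_inv, hs', mul_inv_cancel]
  refine ⟨MonoidHom.mk' (fun e => ⟨e * (s (f.rangeRestrict e))⁻¹, hk e⟩) fun a b => ?_, fun a => ?_⟩
  · apply Subtype.ext
    have := Subgroup.mem_center_iff.1 (hf (hk b)) (s (f.rangeRestrict a))⁻¹
    simp only [map_mul, mul_inv_rev, Subgroup.coe_mul]
    rw [mul_assoc a (s _)⁻¹, this]
    group
  · apply Subtype.ext
    have : f.rangeRestrict a = 1 := Subtype.ext a.2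
    simp [this]

/-- The kernel of a central extension of a free group embeds in the abelianization, because it is an
abelian retract. -/
theorem MonoidHom.disjoint_commutator_ker_of_free {E : Type*} {X : Type*} [Group E]
    (f : E →* FreeGroup X) (hf : f.ker ≤ Subgroup.center E) :
    Disjoint (commutator E) f.ker := by
  obtain ⟨ρ, hρ⟩ := f.exists_retraction_of_free hf
  rw [Subgroup.disjoint_def]
  intro x hx hxA
  have hcomm (a b : f.ker) : a * b = b * a :=
    Subtype.ext (Subgroup.mem_center_iff.1 (hf b.2) a)
  have : commutator E ≤ ρ.ker := by
    rw [commutator_def, Subgroup.commutator_le]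
    intro a _ b _
    rw [MonoidHom.mem_ker, map_commutatorElement, commutatorElement_eq_one_iff_mul_comm]
    exact hcomm _ _
  have h1 : ρ x = 1 := this hx
  have h2 := hρ ⟨x, hxA⟩
  exact congrArg Subtype.val (h2.symm.trans h1)

/-! ### Surface groups are free-by-cyclic -/

/-- A group with a homomorphism to the infinite cyclic group (not necessarily onto) whose kernel is
free. Freeness is recorded as an embedding into some free group `FreeGroup X`, which is equivalent
by the Nielsen–Schreier theorem and passes directly to subgroups. -/
def IsFreeByCyclic (S : Type*) [Group S] : Prop :=
  ∃ (X : Type) (p : S →* Multiplicative ℤ) (f : p.ker →* FreeGroup X), Function.Injective f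

theorem MonoidHom.map_zpow_mulAut {F H : Type*} [Group F] [Group H] (f : F →* H) (τ : MulAut F)
    (σ : MulAut H) (h : ∀ x, f (τ x) = σ (f x)) (n : ℤ) (x : F) :
    f ((τ ^ n) x) = (σ ^ n) (f x) := by
  induction n generalizing x with
  | zero => simp
  | succ n ih => simp only [zpow_add_one, MulAut.mul_apply, ih, h]
  | pred n ih =>
    have h' : f (τ⁻¹ x) = σ⁻¹ (f x) := by
      rw [← σ.injective.eq_iff, ← h, MulAut.apply_inv_self, MulAut.apply_inv_self]
    simp only [zpow_sub_one, MulAut.mul_apply, ih, h']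

namespace SurfaceGroup

/-- The product of commutators `[x₁, y₁] ⋯ [x_k, y_k]` in an arbitrary group, where the `xᵢ` are
indexed by the left summand and the `yᵢ` by the right one. -/
def commutatorProd (k : ℕ) {H : Type*} [Group H] (x : Fin k ⊕ Fin k → H) : H :=
  (List.ofFn fun i : Fin k => x (.inl i) * x (.inr i) * (x (.inl i))⁻¹ * (x (.inr i))⁻¹).prod

theorem map_commutatorProd {k : ℕ} {H H' : Type*} [Group H] [Group H'] (φ : H →* H')
    (x : Fin k ⊕ Fin k → H) : φ (commutatorProd k x) = commutatorProd k fun i => φ (x i) := by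
  simp only [commutatorProd, map_list_prod, List.map_ofFn]
  congr 2
  ext i
  simp

theorem lift_surfaceRelator (k : ℕ) {H : Type*} [Group H] (x : Fin (k + 1) ⊕ Fin (k + 1) → H) :
    FreeGroup.lift x (surfaceRelator (k + 1)) =
      x (.inl 0) * x (.inr 0) * (x (.inl 0))⁻¹ * (x (.inr 0))⁻¹ *
        commutatorProd k (x ∘ Sum.map Fin.succ Fin.succ) := by
  have h : surfaceRelator (k + 1) =
      .of (.inl 0) * .of (.inr 0) * (.of (.inl 0))⁻¹ * (.of (.inr 0))⁻¹ *
        commutatorProd k (fun i => .of (Sum.map Fin.succ Fin.succ i)) := by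
    simp only [surfaceRelator, commutatorProd, List.ofFn_succ, List.prod_cons, Sum.map_inl,
      Sum.map_inr]
  rw [h, map_mul, map_commutatorProd]
  simp [Function.comp_def]

/-- In the surface group of genus `k + 1`, the defining relation solved for the product of all
commutators but the first. -/
theorem commutatorProd_of_eq (k : ℕ) : commutatorProd k (fun i =>
      (PresentedGroup.of (Sum.map Fin.succ Fin.succ i) : SurfaceGroup (k + 1))) =
    (.of (.inr 0)) * (.of (.inl 0)) * (.of (.inr 0))⁻¹ * (.of (.inl 0))⁻¹ := by
  have h : PresentedGroup.mk {surfaceRelator (k + 1)} (surfaceRelator (k + 1)) = 1 :=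
    PresentedGroup.one_of_mem rfl
  have h' : PresentedGroup.mk {surfaceRelator (k + 1)} = FreeGroup.lift PresentedGroup.of := by
    ext; simp [PresentedGroup.of]
  rw [h', lift_surfaceRelator] at h
  refine (eq_inv_of_mul_eq_one_right h).trans ?_
  simp [mul_assoc]

/-- Free generators for the fundamental group of the infinite cyclic cover of the surface of genus
`k + 1` that unwinds the loop `a₁`: the loop `b₁` (`none`), and the conjugates by `a₁ ^ n` of the
loops `aᵢ`, `bᵢ` with `i ≥ 2` (`some (i, n)`, indexed by the remaining `k` handles). -/
abbrev CoverGenerator (k : ℕ) : Type := Option ((Fin k ⊕ Fin k) × ℤ)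

/-- The product of the commutators `[aᵢ, bᵢ]` over `i ≥ 2`, conjugated by `a₁ ^ n`. -/
def tailWord (k : ℕ) (n : ℤ) : FreeGroup (CoverGenerator k) :=
  commutatorProd k fun i => FreeGroup.of (some (i, n))

/-- The action of conjugation by `a₁` on the fundamental group of the infinite cyclic cover. The
value at `b₁` is forced by the surface relation `a₁ b₁ a₁⁻¹ b₁⁻¹ [a₂, b₂] ⋯ = 1`. -/
def shiftHom (k : ℕ) : FreeGroup (CoverGenerator k) →* FreeGroup (CoverGenerator k) :=
  FreeGroup.lift fun
    | none => (tailWord k 0)⁻¹ * FreeGroup.of none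
    | some (i, n) => FreeGroup.of (some (i, n + 1))

/-- The inverse of `shiftHom`. -/
def shiftInvHom (k : ℕ) : FreeGroup (CoverGenerator k) →* FreeGroup (CoverGenerator k) :=
  FreeGroup.lift fun
    | none => tailWord k (-1) * FreeGroup.of none
    | some (i, n) => FreeGroup.of (some (i, n - 1))

theorem shiftHom_tailWord (k : ℕ) (n : ℤ) : shiftHom k (tailWord k n) = tailWord k (n + 1) := by
  simp [tailWord, map_commutatorProd, shiftHom]

theorem shiftInvHom_tailWord (k : ℕ) (n : ℤ) : shiftInvHom k (tailWord k n) = tailWord k (n - 1) := by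
  simp [tailWord, map_commutatorProd, shiftInvHom]

/-- The deck transformation `shiftHom` as an automorphism. -/
def shift (k : ℕ) : MulAut (FreeGroup (CoverGenerator k)) :=
  (shiftHom k).toMulEquiv (shiftInvHom k)
    (by
      ext (_ | ⟨i, n⟩)
      · have h : shiftHom k (.of none) = (tailWord k 0)⁻¹ * .of none := by simp [shiftHom]
        have h' : shiftInvHom k (.of none) = tailWord k (-1) * .of none := by simp [shiftInvHom]
        simp [h, h', shiftInvHom_tailWord]
      · simp [shiftHom, shiftInvHom])
    (by
      ext (_ | ⟨i, n⟩)
      · have h : shiftHom k (.of none) = (tailWord k 0)⁻¹ * .of none := by simp [shiftHom]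
        have h' : shiftInvHom k (.of none) = tailWord k (-1) * .of none := by simp [shiftInvHom]
        simp [h, h', shiftHom_tailWord]
      · simp [shiftHom, shiftInvHom])

theorem shift_of_none (k : ℕ) : shift k (.of none) = (tailWord k 0)⁻¹ * .of none := by
  simp [shift, shiftHom]

theorem shift_of_some (k : ℕ) (i : Fin k ⊕ Fin k) (n : ℤ) :
    shift k (.of (some (i, n))) = .of (some (i, n + 1)) := by
  simp [shift, shiftHom]

/-- The semidirect product of the free group on `CoverGenerator k` with `ℤ`, which acts by powers of
`shift k`. -/
abbrev MappingTorus (k : ℕ) : Type :=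
  FreeGroup (CoverGenerator k) ⋊[zpowersHom _ (shift k)] Multiplicative ℤ

open SemidirectProduct in
/-- The images of the generators of the surface group in `MappingTorus k`: `a₁` goes to the
generator of `ℤ`, the others to the corresponding free generators. -/
def toMappingTorusGen (k : ℕ) : Fin (k + 1) ⊕ Fin (k + 1) → MappingTorus k
  | .inl i => Fin.cases (inr (Multiplicative.ofAdd 1)) (fun i => inl (.of (some (.inl i, 0)))) i
  | .inr i => Fin.cases (inl (.of none)) (fun i => inl (.of (some (.inr i, 0)))) i

open SemidirectProduct in
theorem toMappingTorusGen_comp_succ (k : ℕ) : toMappingTorusGen k ∘ Sum.map Fin.succ Fin.succ =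
    fun i => inl (.of (some (i, 0))) := by
  ext1 (i | i) <;> rfl

open SemidirectProduct in
/-- The homomorphism given on generators by `toMappingTorusGen`. It is injective, with left inverse
`ofMappingTorus`. -/
def toMappingTorus (k : ℕ) : SurfaceGroup (k + 1) →* MappingTorus k :=
  PresentedGroup.toGroup (f := toMappingTorusGen k) <| by
    rintro _ rfl
    rw [lift_surfaceRelator, toMappingTorusGen_comp_succ, ← map_commutatorProd inl]
    have h : (inr (Multiplicative.ofAdd 1) * inl (.of none) * (inr (Multiplicative.ofAdd 1))⁻¹ :
        MappingTorus k) = inl ((tailWord k 0)⁻¹ * .of none) := by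
      rw [← map_inv, ← inl_aut, ← shift_of_none]
      simp
    change (inr (Multiplicative.ofAdd 1) * inl (.of none) * (inr (Multiplicative.ofAdd 1))⁻¹ :
        MappingTorus k) * (inl (.of none))⁻¹ * inl (tailWord k 0) = 1
    rw [h]
    simp

/-- The homomorphism from the free group on `CoverGenerator k` to the surface group in which
`some (i, n)` goes to the conjugate by `a₁ ^ n` of the generator that `i` stands for. -/
def toSurfaceGroup (k : ℕ) : FreeGroup (CoverGenerator k) →* SurfaceGroup (k + 1) :=
  FreeGroup.lift fun
    | none => .of (.inr 0)
    | some (i, n) => MulAut.conj (.of (.inl 0) ^ n) (.of (Sum.map Fin.succ Fin.succ i))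

theorem toSurfaceGroup_shift (k : ℕ) (x : FreeGroup (CoverGenerator k)) :
    toSurfaceGroup k (shift k x) = MulAut.conj (.of (.inl 0)) (toSurfaceGroup k x) := by
  suffices (toSurfaceGroup k).comp (shift k).toMonoidHom =
      (MulAut.conj (.of (.inl 0))).toMonoidHom.comp (toSurfaceGroup k) from
    DFunLike.congr_fun this x
  ext (_ | ⟨i, n⟩)
  · have h : toSurfaceGroup k (tailWord k 0) = _ :=
      (map_commutatorProd _ _).trans (Eq.trans (by simp [toSurfaceGroup]) (commutatorProd_of_eq k))
    have h' : toSurfaceGroup k (.of none) = .of (.inr 0) := by simp [toSurfaceGroup]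
    simp [shift_of_none, h, h', mul_assoc]
  · simp [shift_of_some, toSurfaceGroup, zpow_one_add, add_comm n 1, mul_assoc]

/-- The left inverse of `toMappingTorus`: it is `toSurfaceGroup` on the free factor and sends the
generator of `ℤ` to `a₁`. -/
def ofMappingTorus (k : ℕ) : MappingTorus k →* SurfaceGroup (k + 1) :=
  SemidirectProduct.lift
    (toSurfaceGroup k) (zpowersHom _ (PresentedGroup.of (.inl 0)))
    (by
      intro n
      refine MonoidHom.ext fun x => ?_
      have h := MonoidHom.map_zpow_mulAut (toSurfaceGroup k) (shift k)
        (MulAut.conj (.of (.inl 0))) (toSurfaceGroup_shift k) n.toAdd x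
      rw [← map_zpow] at h
      exact h)

theorem ofMappingTorus_toMappingTorus (k : ℕ) (x : SurfaceGroup (k + 1)) :
    ofMappingTorus k (toMappingTorus k x) = x := by
  suffices (ofMappingTorus k).comp (toMappingTorus k) = MonoidHom.id _ from DFunLike.congr_fun this x
  ext (i | i)
  · induction i using Fin.cases <;>
      simp [toMappingTorus, toMappingTorusGen, ofMappingTorus, toSurfaceGroup]
  · induction i using Fin.cases <;>
      simp [toMappingTorus, toMappingTorusGen, ofMappingTorus, toSurfaceGroup]

/-- Surface groups of positive genus are free-by-cyclic: the kernel of the homomorphism to `ℤ` with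
`a₁ ↦ 1` and all other generators `↦ 0` embeds in the free factor of `MappingTorus k`. -/
theorem isFreeByCyclic {g : ℕ} (hg : 1 ≤ g) : IsFreeByCyclic (SurfaceGroup g) := by
  obtain ⟨k, rfl⟩ := Nat.exists_eq_succ_of_ne_zero (Nat.one_le_iff_ne_zero.1 hg)
  let p := SemidirectProduct.rightHom.comp (toMappingTorus k)
  refine ⟨CoverGenerator k, p, MonoidHom.mk' (fun x => (toMappingTorus k x).left) ?_, ?_⟩
  · rintro ⟨x, hx⟩ ⟨y, hy⟩
    have hx' : (toMappingTorus k x).right = 1 := hx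
    simp [hx']
  · rintro ⟨x, hx⟩ ⟨y, hy⟩ h
    have hx' : (toMappingTorus k x).right = 1 := hx
    have hy' : (toMappingTorus k y).right = 1 := hy
    have hxy : toMappingTorus k x = toMappingTorus k y := SemidirectProduct.ext h (hx'.trans hy'.symm)
    exact Subtype.ext ((Function.LeftInverse.injective (ofMappingTorus_toMappingTorus k)) hxy)

end SurfaceGroup

/-! ### Extensions with a cyclic complement -/

/-- If the powers of `t` meet `E` trivially, adjoining `t` to a normal subgroup `D ≤ E` adds no
element of `E`. -/
theorem Subgroup.mem_of_mem_sup_zpowers {Γ : Type*} [Group Γ] {D E : Subgroup Γ} [D.Normal]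
    (hDE : D ≤ E) {t : Γ} (ht : ∀ n : ℤ, t ^ n ∈ E → t ^ n = 1) {e : Γ} (he : e ∈ E)
    (h : e ∈ D ⊔ zpowers t) : e ∈ D := by
  obtain ⟨d, hd, _, ⟨n, rfl⟩, rfl⟩ := mem_sup_of_normal_left.1 h
  change d * t ^ n ∈ E at he
  change d * t ^ n ∈ D
  rwa [ht n ((E.mul_mem_cancel_left (hDE hd)).1 he), mul_one]

/-- The kernel `E` of a homomorphism `q` to `ℤ` has a cyclic complement `⟨t⟩`. The second condition
says that `⟨t⟩` meets `E` trivially; when `q` is trivial this forces `t = 1`. -/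
theorem MonoidHom.exists_zpowers_complement_ker {Γ : Type*} [Group Γ]
    (q : Γ →* Multiplicative ℤ) :
    ∃ t : Γ, (∀ γ, ∃ n : ℤ, γ * (t ^ n)⁻¹ ∈ q.ker) ∧ ∀ n : ℤ, t ^ n ∈ q.ker → t ^ n = 1 := by
  obtain ⟨⟨_, t, rfl⟩, ht⟩ := IsCyclic.exists_generator (α := q.range)
  have ht' (γ : Γ) : ∃ n : ℤ, q t ^ n = q γ := by
    obtain ⟨n, hn⟩ := ht ⟨q γ, γ, rfl⟩
    exact ⟨n, congrArg Subtype.val hn⟩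
  by_cases h : q t = 1
  · refine ⟨1, fun γ => ⟨0, ?_⟩, by simp⟩
    obtain ⟨n, hn⟩ := ht' γ
    simp [MonoidHom.mem_ker, ← hn, h]
  · refine ⟨t, fun γ => ?_, fun n hn => ?_⟩
    · obtain ⟨n, hn⟩ := ht' γ
      exact ⟨n, by simp [MonoidHom.mem_ker, hn]⟩
    · rw [MonoidHom.mem_ker, map_zpow] at hn
      have hn' : n * (q t).toAdd = 0 := by simpa using congrArg Multiplicative.toAdd hn
      have h' : (q t).toAdd ≠ 0 := h
      rw [(mul_eq_zero.1 hn').resolve_right h', zpow_zero]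

theorem Abelianization.of_surjective {G : Type*} [Group G] :
    Function.Surjective (Abelianization.of : G →* Abelianization G) :=
  QuotientGroup.mk'_surjective _

namespace Subgroup

variable {Γ : Type*} [Group Γ] (E : Subgroup Γ)

/-- The action of `Γ` by conjugation on the abelianization of a normal subgroup `E`, written
additively, as a representation over `ℤ`. -/
def conjAbelianization [E.Normal] : Representation ℤ Γ (Additive (Abelianization E)) where
  toFun γ :=
    (Abelianization.map (MulAut.conjNormal γ : MulAut E).toMonoidHom).toAdditive.toIntLinearMap
  map_one' := by
    refine LinearMap.ext fun x => ?_
    obtain ⟨e, rfl⟩ := Abelianization.of_surjective x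
    simp
    rfl
  map_mul' γ δ := by
    refine LinearMap.ext fun x => ?_
    obtain ⟨e, rfl⟩ := Abelianization.of_surjective x
    simp
    rfl

/-- The preimage in `E`, as a subgroup of `Γ`, of a subgroup of the abelianization of `E`. -/
def abelianizationPreimage (C : AddSubgroup (Additive (Abelianization E))) : Subgroup Γ :=
  ((AddSubgroup.toSubgroup' C).comap Abelianization.of).map E.subtype

variable {E}

theorem coe_mem_abelianizationPreimage {C : AddSubgroup (Additive (Abelianization E))} {e : E} :
    (e : Γ) ∈ E.abelianizationPreimage C ↔ .ofMul (.of e) ∈ C := by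
  simp [abelianizationPreimage]

theorem abelianizationPreimage_le (C : AddSubgroup (Additive (Abelianization E))) :
    E.abelianizationPreimage C ≤ E := by
  rintro _ ⟨e, -, rfl⟩
  exact e.2

/-- If `Γ = E ⟨t⟩`, the preimage of a subgroup of the abelianization of `E` that is stable under `t`
is normal in `Γ`, since `E` acts trivially on its abelianization. -/
theorem abelianizationPreimage_normal [E.Normal] {t : Γ}
    (ht : ∀ γ, ∃ n : ℤ, γ * (t ^ n)⁻¹ ∈ E) {C : AddSubgroup (Additive (Abelianization E))}
    (hC : ∀ n : ℤ, ∀ c ∈ C, E.conjAbelianization (t ^ n) c ∈ C) :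
    (E.abelianizationPreimage C).Normal := by
  refine ⟨?_⟩
  rintro _ ⟨e, he, rfl⟩ γ
  obtain ⟨n, hn⟩ := ht γ
  have h : γ * (E.subtype e) * γ⁻¹ = (MulAut.conjNormal γ e : E) := by simp
  rw [h, coe_mem_abelianizationPreimage]
  have h' : (MulAut.conjNormal γ e : E) = ⟨_, hn⟩ * MulAut.conjNormal (t ^ n) e * ⟨_, hn⟩⁻¹ := by
    apply Subtype.ext
    simp [mul_assoc, -map_zpow]
  have h'' : (Abelianization.of (MulAut.conjNormal γ e : E)) =
      Abelianization.of (MulAut.conjNormal (t ^ n) e) := by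
    rw [h', map_mul, map_mul, map_inv, mul_comm, inv_mul_cancel_left]
  rw [h'']
  exact hC n _ he

/-- If `Γ = E ⋊ ⟨t⟩` is finitely generated, the abelianization of `E` is a finitely generated
`ℤ[t, t⁻¹]`-module. -/
theorem finite_conjAbelianization [Group.FG Γ] [E.Normal] {t : Γ}
    (ht : ∀ γ, ∃ n : ℤ, γ * (t ^ n)⁻¹ ∈ E) (ht' : ∀ n : ℤ, t ^ n ∈ E → t ^ n = 1) :
    Module.Finite (MonoidAlgebra ℤ (Multiplicative ℤ))
      (Representation.asModule (E.conjAbelianization.comp (zpowersHom Γ t))) := by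
  set ρ : Representation ℤ (Multiplicative ℤ) (Additive (Abelianization E)) :=
    E.conjAbelianization.comp (zpowersHom Γ t)
  obtain ⟨S, hS, hSfin⟩ := Group.fg_iff.1 ‹Group.FG Γ›
  choose n hn using ht
  -- A generator `γ` of `Γ` is decomposed as `e * t ^ n γ` with `e ∈ E`, and `v γ` is the class of `e`.
  -- The preimage of the submodule `W` spanned by these classes is a normal subgroup that generates
  -- `Γ` together with `t`, so it is all of `E`.
  let v (γ : Γ) : ρ.asModule :=
    ρ.asModuleEquiv.symm (.ofMul (.of (⟨γ * (t ^ n γ)⁻¹, hn γ⟩ : E)))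
  let W : Submodule (MonoidAlgebra ℤ (Multiplicative ℤ)) ρ.asModule := Submodule.span _ (v '' S)
  let C := W.toAddSubgroup.comap ρ.asModuleEquiv.symm.toAddEquiv.toAddMonoidHom
  have : (E.abelianizationPreimage C).Normal := by
    refine abelianizationPreimage_normal (t := t) (fun γ => ⟨n γ, hn γ⟩) fun m c hc => ?_
    exact ρ.asModuleEquiv_symm_apply_mem W (Multiplicative.ofAdd m) hc
  have htop : E.abelianizationPreimage C ⊔ zpowers t = ⊤ := by
    rw [eq_top_iff, ← hS, closure_le]
    intro γ hγ
    have hv : v γ ∈ W := Submodule.subset_span ⟨γ, hγ, rfl⟩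
    have h : (⟨γ * (t ^ n γ)⁻¹, hn γ⟩ : E).1 ∈ E.abelianizationPreimage C :=
      coe_mem_abelianizationPreimage.2 hv
    rw [← inv_mul_cancel_right γ (t ^ n γ)]
    exact mul_mem_sup h (zpow_mem (mem_zpowers t) _)
  refine ⟨⟨(hSfin.image v).toFinset, ?_⟩⟩
  rw [Set.Finite.coe_toFinset, eq_top_iff]
  rintro x -
  obtain ⟨e, he⟩ := Abelianization.of_surjective (ρ.asModuleEquiv x).toMul
  have h := mem_of_mem_sup_zpowers (abelianizationPreimage_le C) ht' e.2 (htop ▸ mem_top _)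
  rw [coe_mem_abelianizationPreimage, he] at h
  exact h

/-- If `Γ = E K` and `K ∩ E` has finite index in `E`, then `K` has finite index in `Γ`. -/
theorem finiteIndex_of_relIndex_ne_zero {K E : Subgroup Γ} (hKE : K.relIndex E ≠ 0)
    (h : ∀ γ, ∃ e ∈ E, e⁻¹ * γ ∈ K) : K.FiniteIndex := by
  have : (K.subgroupOf E).FiniteIndex := ⟨hKE⟩
  rw [finiteIndex_iff_finite_quotient]
  refine Finite.of_surjective (α := E ⧸ K.subgroupOf E) (fun x => (x.out : Γ ⧸ K)) fun y => ?_
  obtain ⟨γ, rfl⟩ := QuotientGroup.mk_surjective y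
  obtain ⟨e, he, heγ⟩ := h γ
  refine ⟨QuotientGroup.mk ⟨e, he⟩, ?_⟩
  obtain ⟨k, hk⟩ := QuotientGroup.mk_out_eq_mul (K.subgroupOf E) ⟨e, he⟩
  change ((QuotientGroup.mk ⟨e, he⟩ : E ⧸ K.subgroupOf E).out.1 : Γ ⧸ K) = _
  rw [hk, QuotientGroup.eq]
  have hk' : (k : Γ) ∈ K := k.2
  simpa [mul_assoc] using K.mul_mem (K.inv_mem hk') heγ

/-- Let `Γ = E ⋊ ⟨t⟩` be finitely generated. A finite subgroup `A` of `E` that is central in `Γ` and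
embeds in the abelianization of `E` meets some subgroup of finite index of `Γ` trivially. -/
theorem exists_finiteIndex_disjoint_of_zpowers_complement [Group.FG Γ] [E.Normal] {t : Γ}
    (ht : ∀ γ, ∃ n : ℤ, γ * (t ^ n)⁻¹ ∈ E) (ht' : ∀ n : ℤ, t ^ n ∈ E → t ^ n = 1)
    (A : Subgroup Γ) [Finite A] (hA : A ≤ center Γ) (hAE : A ≤ E)
    (hcomm : Disjoint (_root_.commutator E) (A.subgroupOf E)) :
    ∃ K : Subgroup Γ, K.FiniteIndex ∧ Disjoint K A := by
  have := finite_conjAbelianization ht ht'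
  let A' : AddSubgroup (Additive (Abelianization E)) :=
    Subgroup.toAddSubgroup ((A.subgroupOf E).map Abelianization.of)
  have hAfin : Finite (A.subgroupOf E) := Finite.of_equiv A (subgroupOfEquivOfLe hAE).symm
  have hA'fin : Finite A' :=
    (Set.Finite.image Abelianization.of (Set.toFinite (A.subgroupOf E : Set E))).to_subtype
  obtain ⟨C, hCfin, hCinv, hCA⟩ := Representation.exists_finite_quotient_disjoint
    (E.conjAbelianization.comp (zpowersHom Γ t)) A' (by
      rintro m _ ⟨a, ha, rfl⟩
      have h : (MulAut.conjNormal (zpowersHom Γ t m) a : E) = a := by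
        apply Subtype.ext
        have := mem_center_iff.1 (hA ha) (zpowersHom Γ t m)
        rw [MulAut.conjNormal_apply, mul_inv_eq_iff_eq_mul]
        exact this
      exact congrArg (fun e => Additive.ofMul (Abelianization.of e)) h)
  have hnormal : (E.abelianizationPreimage C).Normal :=
    abelianizationPreimage_normal ht fun m => hCinv (.ofAdd m)
  -- Since `C` has finite index in the abelianization, adjoining `t` to its preimage gives a subgroup
  -- of finite index in `Γ`, with no new elements in `E`.
  refine ⟨E.abelianizationPreimage C ⊔ zpowers t, ?_, ?_⟩
  · have hrel : (E.abelianizationPreimage C).relIndex E ≠ 0 := by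
      have h : (E.abelianizationPreimage C).subgroupOf E =
          (AddSubgroup.toSubgroup' C).comap Abelianization.of := by
        ext e
        exact coe_mem_abelianizationPreimage
      rw [relIndex, h, index_comap_of_surjective _ Abelianization.of_surjective]
      exact hCfin.index_ne_zero
    refine finiteIndex_of_relIndex_ne_zero
      (fun h => hrel (relIndex_eq_zero_of_le_left le_sup_left h)) fun γ => ?_
    obtain ⟨n, hn⟩ := ht γ
    refine ⟨_, hn, ?_⟩
    simpa using mem_sup_right (S := E.abelianizationPreimage C) (zpow_mem (mem_zpowers t) n)
  · rw [disjoint_def]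
    intro x hx hxA
    have h := mem_of_mem_sup_zpowers (abelianizationPreimage_le C) ht' (hAE hxA) hx
    lift x to E using hAE hxA
    rw [coe_mem_abelianizationPreimage] at h
    have h0 := AddSubgroup.disjoint_def.1 hCA h ⟨x, hxA, rfl⟩
    have h1 : x ∈ _root_.commutator E := (QuotientGroup.eq_one_iff x).1 h0
    exact congrArg Subtype.val (disjoint_def.1 hcomm h1 hxA)

end Subgroup

/-! ### Finite index and finite generation -/

theorem Group.finite_monoidHom_of_fg (Γ Q : Type*) [Group Γ] [Group.FG Γ] [Group Q] [Finite Q] :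
    Finite (Γ →* Q) := by
  obtain ⟨T, hT, hTfin⟩ := Group.fg_iff.1 ‹Group.FG Γ›
  have : Finite T := hTfin
  exact Finite.of_injective (fun (f : Γ →* Q) (x : T) => f x) fun f g h =>
    MonoidHom.eq_of_eqOn_dense hT fun x hx => congrFun h ⟨x, hx⟩

/-- The intersection of the kernels of all homomorphisms to the permutation group of `Γ ⧸ L` is
characteristic, and has finite index because there are finitely many such homomorphisms. -/
theorem Subgroup.exists_characteristic_finiteIndex_le {Γ : Type*} [Group Γ] [Group.FG Γ]
    (L : Subgroup Γ) [L.FiniteIndex] :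
    ∃ K : Subgroup Γ, K.Characteristic ∧ K.FiniteIndex ∧ K ≤ L := by
  have := Group.finite_monoidHom_of_fg Γ (Equiv.Perm (Γ ⧸ L))
  refine ⟨⨅ f : Γ →* Equiv.Perm (Γ ⧸ L), f.ker, ?_, Subgroup.finiteIndex_iInf fun f => inferInstance,
    ?_⟩
  · rw [characteristic_iff_le_comap]
    intro σ x hx
    rw [mem_iInf] at hx
    rw [mem_comap, mem_iInf]
    exact fun f => hx (f.comp σ.toMonoidHom)
  · refine (iInf_le _ (MulAction.toPermHom Γ (Γ ⧸ L))).trans ?_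
    rw [← normalCore_eq_ker]
    exact L.normalCore_le

theorem Group.fg_of_fg_ker {Γ S : Type*} [Group Γ] [Group S] [Group.FG S] (π : Γ →* S)
    (hπ : Function.Surjective π) [Group.FG π.ker] : Group.FG Γ := by
  obtain ⟨T, hT, hTfin⟩ := Group.fg_iff.1 ‹Group.FG π.ker›
  obtain ⟨U, hU, hUfin⟩ := Group.fg_iff.1 ‹Group.FG S›
  refine Group.fg_iff.2 ⟨π.ker.subtype '' T ∪ Function.surjInv hπ '' U, ?_,
    (hTfin.image _).union (hUfin.image _)⟩
  rw [Subgroup.closure_union, ← MonoidHom.map_closure, hT, ← MonoidHom.range_eq_map,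
    Subgroup.range_subtype, sup_comm, ← Subgroup.comap_map_eq, MonoidHom.map_closure,
    ← Set.image_comp]
  have : π ∘ Function.surjInv hπ = id := funext (Function.surjInv_eq hπ)
  rw [this, Set.image_id, hU, Subgroup.comap_top]

/-! ### Extensions of free-by-cyclic groups by finite groups -/

/-- A finitely generated central extension, with finite kernel, of a subgroup of a free-by-cyclic
group splits over a subgroup of finite index. -/
theorem MonoidHom.exists_finiteIndex_disjoint_ker_of_central {Γ S : Type*} [Group Γ] [Group.FG Γ]
    [Group S] (hS : IsFreeByCyclic S) (π : Γ →* S) [Finite π.ker]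
    (hc : π.ker ≤ Subgroup.center Γ) :
    ∃ K : Subgroup Γ, K.FiniteIndex ∧ Disjoint K π.ker := by
  obtain ⟨X, p, f, hf⟩ := hS
  obtain ⟨t, ht, ht'⟩ := (p.comp π).exists_zpowers_complement_ker
  let f' : (p.comp π).ker →* FreeGroup X := f.comp (π.subgroupComap p.ker)
  have hker : f'.ker = π.ker.subgroupOf (p.comp π).ker := by
    ext x
    rw [MonoidHom.mem_ker, Subgroup.mem_subgroupOf, MonoidHom.mem_ker]
    change f _ = 1 ↔ _
    rw [map_eq_one_iff f hf, Subtype.ext_iff]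
    rfl
  refine Subgroup.exists_finiteIndex_disjoint_of_zpowers_complement ht ht' π.ker hc
    (fun x hx => ?_) ?_
  · rw [MonoidHom.mem_ker, MonoidHom.comp_apply, MonoidHom.mem_ker.1 hx, map_one]
  · rw [← hker]
    refine f'.disjoint_commutator_ker_of_free fun x hx => ?_
    rw [hker] at hx
    exact Subgroup.mem_center_iff.2 fun y => Subtype.ext (Subgroup.mem_center_iff.1 (hc hx) y)

/-- Reduction to the central case: the centralizer of the finite kernel has finite index, and is
finitely generated by Schreier's lemma. Its image in `S` is an unspecified subgroup, which is
harmless because the central case does not require `π` to be onto. -/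
theorem MonoidHom.exists_finiteIndex_disjoint_ker {Γ S : Type*} [Group Γ] [Group.FG Γ]
    [Group S] (hS : IsFreeByCyclic S) (π : Γ →* S) [Finite π.ker] :
    ∃ K : Subgroup Γ, K.FiniteIndex ∧ Disjoint K π.ker := by
  let C : Subgroup Γ := (MulAut.conjNormal : Γ →* MulAut π.ker).ker
  have hCfin : C.FiniteIndex := inferInstance
  have : Finite (π.comp C.subtype).ker :=
    Finite.of_injective (β := π.ker) (fun x => ⟨x.1.1, x.2⟩) fun x y h =>
      Subtype.ext (Subtype.ext (congrArg (fun z : π.ker => (z : Γ)) h))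
  obtain ⟨K, hK, hdisj⟩ := (π.comp C.subtype).exists_finiteIndex_disjoint_ker_of_central hS (by
    intro x hx
    refine Subgroup.mem_center_iff.2 fun y => Subtype.ext ?_
    have h : MulAut.conjNormal (y : Γ) (⟨x.1, hx⟩ : π.ker) = ⟨x.1, hx⟩ :=
      DFunLike.congr_fun (MonoidHom.mem_ker.1 y.2) _
    have h' := congrArg Subtype.val h
    rwa [MulAut.conjNormal_apply, mul_inv_eq_iff_eq_mul] at h')
  refine ⟨K.map C.subtype, ⟨?_⟩, ?_⟩
  · rw [Subgroup.index_map_subtype]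
    exact mul_ne_zero hK.index_ne_zero hCfin.index_ne_zero
  · rw [Subgroup.disjoint_def]
    rintro _ ⟨x, hx, rfl⟩ hx'
    exact congrArg Subtype.val (Subgroup.disjoint_def.1 hdisj hx hx')

/-- The relative form of `MonoidHom.exists_finiteIndex_disjoint_ker`, obtained from `Γ ⧸ K`. -/
theorem MonoidHom.exists_finiteIndex_inf_ker_le {Γ S : Type*} [Group Γ] [Group.FG Γ]
    [Group S] (hS : IsFreeByCyclic S) (π : Γ →* S) (K : Subgroup Γ) [K.Normal] (hK : K ≤ π.ker)
    (hK' : K.relIndex π.ker ≠ 0) :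
    ∃ L : Subgroup Γ, L.FiniteIndex ∧ L ⊓ π.ker ≤ K := by
  let ψ : Γ ⧸ K →* S := QuotientGroup.lift K π hK
  have : Finite ψ.ker := by
    have : (K.subgroupOf π.ker).FiniteIndex := ⟨hK'⟩
    refine Finite.of_surjective (α := π.ker ⧸ K.subgroupOf π.ker)
      (fun x => ⟨(x.out.1 : Γ ⧸ K), x.out.2⟩) ?_
    rintro ⟨y, hy⟩
    obtain ⟨γ, rfl⟩ := QuotientGroup.mk_surjective y
    refine ⟨QuotientGroup.mk ⟨γ, hy⟩, Subtype.ext ?_⟩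
    obtain ⟨k, hk⟩ := QuotientGroup.mk_out_eq_mul (K.subgroupOf π.ker) ⟨γ, hy⟩
    have hk' : (k : Γ) ∈ K := k.2
    change ((QuotientGroup.mk ⟨γ, hy⟩ : π.ker ⧸ K.subgroupOf π.ker).out.1 : Γ ⧸ K) = _
    rw [hk, eq_comm, QuotientGroup.eq]
    simpa using hk'
  obtain ⟨L, hL, hdisj⟩ := ψ.exists_finiteIndex_disjoint_ker hS
  refine ⟨L.comap (QuotientGroup.mk' K), ⟨?_⟩, fun x hx => ?_⟩
  · rw [Subgroup.index_comap_of_surjective _ (QuotientGroup.mk'_surjective K)]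
    exact hL.index_ne_zero
  · exact (QuotientGroup.eq_one_iff x).1 (Subgroup.disjoint_def.1 hdisj hx.1 hx.2)

/-! ### Extensions of polysurface groups -/

instance SurfaceGroup.fg (g : ℕ) : Group.FG (SurfaceGroup g) :=
  inferInstanceAs (Group.FG (_ ⧸ _))

/-- Every extension of a polysurface group by a finite group splits over a subgroup of finite index.
The proof climbs the preimages of the filtration: each is finitely generated and has a subgroup of
finite index that is normal in the whole group and misses the kernel. -/
theorem IsPolysurfaceGroup.exists_finiteIndex_disjoint_ker {Γ G : Type*} [Group Γ] [Group G]
    {n : ℕ} (hG : IsPolysurfaceGroup G n) (π : Γ →* G) (hπ : Function.Surjective π)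
    [hfin : Finite π.ker] : ∃ K : Subgroup Γ, K.FiniteIndex ∧ Disjoint K π.ker := by
  obtain ⟨F, hnormal, hbot, htop, hmono, hquot⟩ := hG
  suffices h : ∀ i, Group.FG ((F i).comap π) ∧ ∃ K : Subgroup Γ, K.Normal ∧ K ≤ (F i).comap π ∧
      K.relIndex ((F i).comap π) ≠ 0 ∧ Disjoint K π.ker by
    obtain ⟨-, K, -, -, hK, hdisj⟩ := h (Fin.last n)
    rw [htop, Subgroup.comap_top, Subgroup.relIndex_top_right] at hK
    exact ⟨K, ⟨hK⟩, hdisj⟩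
  intro i
  induction i using Fin.induction with
  | zero =>
    rw [hbot, MonoidHom.comap_bot]
    refine ⟨inferInstance, ⊥, inferInstance, bot_le, ?_, disjoint_bot_left⟩
    rw [Subgroup.relIndex_bot_left]
    exact Nat.card_pos.ne'
  | succ i ih =>
    obtain ⟨hfg, K, hKnormal, hKle, hKindex, hKdisj⟩ := ih
    obtain ⟨g, hg, ⟨e⟩⟩ := hquot i
    -- `p` is the projection of `M'` to the surface group, with kernel `M`. Modulo `K`, the group `M'`
    -- is an extension of the surface group by a finite group.
    let M := (F i.castSucc).comap π
    let M' := (F i.succ).comap π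
    have hMM' : M ≤ M' := Subgroup.comap_mono (hmono i.castSucc_lt_succ).le
    let p : M' →* SurfaceGroup g := e.toMonoidHom.comp
      ((QuotientGroup.mk' ((F i.castSucc).subgroupOf (F i.succ))).comp (π.subgroupComap (F i.succ)))
    have hp : Function.Surjective p := e.surjective.comp
      ((QuotientGroup.mk'_surjective _).comp (π.subgroupComap_surjective_of_surjective _ hπ))
    have hker : p.ker = M.subgroupOf M' := by
      ext x
      refine (map_eq_one_iff e e.injective).trans ?_
      exact QuotientGroup.eq_one_iff _
    have hkerfg : Group.FG p.ker := by
      rw [hker]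
      exact Group.fg_of_surjective (f := (Subgroup.subgroupOfEquivOfLe hMM').symm.toMonoidHom)
        (Subgroup.subgroupOfEquivOfLe hMM').symm.surjective
    have hM'fg : Group.FG M' := Group.fg_of_fg_ker p hp
    refine ⟨hM'fg, ?_⟩
    obtain ⟨L, hL, hLK⟩ := p.exists_finiteIndex_inf_ker_le
      (SurfaceGroup.isFreeByCyclic (one_le_two.trans hg)) (K.subgroupOf M')
      (hker ▸ Subgroup.comap_mono hKle) (by
        rwa [hker, Subgroup.relIndex_subgroupOf hMM'])
    -- A characteristic subgroup of `M'` is normal in `Γ`, as the next step of the filtration needs.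
    obtain ⟨L', hL'char, hL', hL'L⟩ := L.exists_characteristic_finiteIndex_le
    have hM'normal : M'.Normal := (hnormal i.succ).comap π
    refine ⟨L'.map M'.subtype, inferInstance, ?_, ?_, ?_⟩
    · rintro _ ⟨x, -, rfl⟩
      exact x.2
    · have : (L'.map M'.subtype).subgroupOf M' = L' :=
        Subgroup.comap_map_eq_self_of_injective M'.subtype_injective L'
      change (L'.map M'.subtype).relIndex M' ≠ 0
      rw [Subgroup.relIndex, this]
      exact hL'.index_ne_zero
    · rw [Subgroup.disjoint_def]
      rintro _ ⟨x, hx, rfl⟩ hxπ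
      have hxM : (x : Γ) ∈ M := by
        have : π x = 1 := hxπ
        simp [M, this, one_mem]
      have hxp : x ∈ p.ker := hker ▸ hxM
      exact Subgroup.disjoint_def.1 hKdisj (hLK ⟨hL'L hx, hxp⟩) hxπ

/-- A subgroup `K` missing the kernel of a central extension gives a splitting over its image, hence
an equivalence with the direct product. -/
theorem GroupExtension.isTrivial_restrict_range {A E G : Type*} [Group A] [Group E] [Group G]
    (S : GroupExtension A E G) (hS : S.IsCentral) (K : Subgroup E)
    (hK : Disjoint K S.rightHom.ker) :
    (S.restrict (S.rightHom.comp K.subtype).range).IsTrivial := by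
  set H := (S.rightHom.comp K.subtype).range
  have hinj : Function.Injective (S.rightHom.comp K.subtype) := by
    rw [injective_iff_map_eq_one]
    exact fun x hx => Subtype.ext (Subgroup.disjoint_def.1 hK x.2 hx)
  let e : K ≃* H := MonoidHom.ofInjective hinj
  let s : H →* H.comap S.rightHom :=
    (K.subtype.codRestrict (H.comap S.rightHom) fun x =>
      show S.rightHom x ∈ H from ⟨x, rfl⟩).comp e.symm.toMonoidHom
  have hs (h : H) : S.rightHom (s h) = h := congrArg Subtype.val (e.apply_symm_apply h)
  have hcomm (a : A) (h : H) : Commute ((S.restrict H).inl a) (s h) :=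
    Subtype.ext (Subgroup.mem_center_iff.1 (hS ⟨a, rfl⟩) (s h)).symm
  refine ⟨(GroupExtension.Equiv.ofMonoidHom
    ((S.restrict H).inl.noncommCoprod s hcomm) ?_ ?_).symm⟩
  · ext a
    simp [directProduct]
  · ext ⟨a, h⟩
    simp only [MonoidHom.comp_apply, MonoidHom.noncommCoprod_apply, map_mul, rightHom_inl, one_mul]
    exact hs h

theorem mainTheorem9 {G A Γ : Type*} [Group G] [CommGroup A] [Finite A] [Group Γ]
    (n : ℕ) (hG : IsPolysurfaceGroup G n)
    (S : GroupExtension A Γ G) (hS : S.IsCentral) :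
    ∃ H : Subgroup G, H.FiniteIndex ∧ (S.restrict H).IsTrivial := by
  have : Finite S.rightHom.ker := by
    rw [← S.range_inl_eq_ker_rightHom]
    exact Finite.of_surjective _ S.inl.rangeRestrict_surjective
  obtain ⟨K, hK, hdisj⟩ := hG.exists_finiteIndex_disjoint_ker S.rightHom S.rightHom_surjective
  refine ⟨_, ⟨?_⟩, S.isTrivial_restrict_range hS K hdisj⟩
  rw [MonoidHom.range_comp, Subgroup.range_subtype]
  exact ne_zero_of_dvd_ne_zero hK.index_ne_zero (K.index_map_dvd S.rightHom_surjective)
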